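/- A diffeology on a real vector space is a \emph{vector space diffeology} if addition and scalar multiplication are smooth for it (with $\mathbb{R}$ carrying its standard diffeology); the vector space diffeology \emph{generated} by a set of maps is the smallest one having all of them as plots. A diffeology on a finite-dimensional real vector space is \emph{standard} if its plots are exactly the ordinary smooth maps. Let $\Delta_{\mathbb{Q}}:\mathbb{R}\to\mathbb{R}$ be $0$ on $\mathbb{Q}$ and $1$ on $\mathbb{R}\setminus\mathbb{Q}$, and let $V$ be $\mathbb{R}^2$ endowed with the vector space diffeology generated by the two maps $x\mapsto(|x|,|x|)$ and $x\mapsto(0,\Delta_{\mathbb{Q}}(x))$, $\mathbb{R}\to\mathbb{R}^2$. Then the subset diffeology (inherited from $V$) on every non-zero vector subspace $W$ of $V$ is non-standard. Moreover, for all $a,b\in\mathbb{R}$ the map $x\mapsto(a|x|,b|x|)$ is a plot of $V$; and if $(a,b)\neq(0,0)$, this map takes values in $\mathrm{Span}((a,b))$ and is a plot of the subset diffeology on $\mathrm{Span}((a,b))$ that is not a plot of the standard diffeology on $\mathrm{Span}((a,b))$. -/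

import Mathlib

open scoped ContDiff

namespace DiffVS

/-- The pullback along `f : X → Y` of a diffeology on `Y`: a map `p : ℝⁿ → X` is a plot
iff `f ∘ p` is a plot of `Y`. -/
@[reducible]
def pullback {X Y : Type*} (f : X → Y) (d : DiffeologicalSpace Y) : DiffeologicalSpace X where
  plots n := {p | f ∘ p ∈ d.plots n}
  constant_plots x := d.constant_plots (f x)
  plot_reparam hp hf := d.plot_reparam hp hf
  locality hp := d.locality fun x => by
    obtain ⟨u, hu, hxu, h⟩ := hp x
    exact ⟨u, hu, hxu, fun hm hf => h hm hf⟩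

/-- The product diffeology: a map into `X × Y` is a plot iff both its components are plots. -/
@[reducible]
def prodDiffeology {X Y : Type*} (dX : DiffeologicalSpace X) (dY : DiffeologicalSpace Y) :
    DiffeologicalSpace (X × Y) :=
  pullback Prod.fst dX ⊓ pullback Prod.snd dY

/-- A vector space diffeology on a real vector space: addition `E × E → E` and scalar
multiplication `ℝ × E → E` are smooth, for the product diffeologies and with `ℝ` carrying its
standard diffeology. -/
structure IsVectorSpaceDiffeology {E : Type*} [AddCommGroup E] [Module ℝ E]
    (d : DiffeologicalSpace E) : Prop where
  smooth_add : @Diffeology.DSmooth (E × E) E (prodDiffeology d d) d fun z => z.1 + z.2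
  smooth_smul : @Diffeology.DSmooth (ℝ × E) E
    (prodDiffeology (NormedSpace.toDiffeology ℝ) d) d fun z => z.1 • z.2

/-- A map `c : ℝ → X` is a plot of the diffeology `d`, where `ℝ` is identified with `ℝ¹`. -/
def IsCurvePlot {X : Type*} (d : DiffeologicalSpace X) (c : ℝ → X) : Prop :=
  @Diffeology.IsPlot X d 1 fun t => c (t 0)

/-- The vector space diffeology generated by a set `S` of maps `ℝ → E`: the smallest vector space
diffeology on `E` among whose plots are all the elements of `S`
(diffeologies are ordered by inclusion of their sets of plots). -/
@[reducible]
noncomputable def vectorSpaceDiffeologyGeneratedBy {E : Type*} [AddCommGroup E] [Module ℝ E]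
    (S : Set (ℝ → E)) : DiffeologicalSpace E :=
  sInf {d | IsVectorSpaceDiffeology d ∧ ∀ c ∈ S, IsCurvePlot d c}

/-- The generated vector space diffeology is the least element of the family defining it. -/
theorem isLeast_vectorSpaceDiffeologyGeneratedBy {E : Type*} [AddCommGroup E] [Module ℝ E]
    (S : Set (ℝ → E)) :
    IsLeast {d : DiffeologicalSpace E | IsVectorSpaceDiffeology d ∧ ∀ c ∈ S, IsCurvePlot d c}
      (vectorSpaceDiffeologyGeneratedBy S) := by
  refine ⟨⟨⟨?_, ?_⟩, ?_⟩, fun d hd => sInf_le hd⟩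
  · intro n p hp
    rw [DiffeologicalSpace.isPlot_inf_iff] at hp
    refine DiffeologicalSpace.isPlot_sInf_iff.2 fun d hd => hd.1.smooth_add n p ?_
    exact DiffeologicalSpace.isPlot_inf_iff.2
      ⟨DiffeologicalSpace.isPlot_sInf_iff.1 hp.1 d hd,
        DiffeologicalSpace.isPlot_sInf_iff.1 hp.2 d hd⟩
  · intro n p hp
    rw [DiffeologicalSpace.isPlot_inf_iff] at hp
    refine DiffeologicalSpace.isPlot_sInf_iff.2 fun d hd => hd.1.smooth_smul n p ?_
    exact DiffeologicalSpace.isPlot_inf_iff.2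
      ⟨hp.1, DiffeologicalSpace.isPlot_sInf_iff.1 hp.2 d hd⟩
  · exact fun c hc => DiffeologicalSpace.isPlot_sInf_iff.2 fun d hd => hd.2 c hc

/-- The subset diffeology on a subspace `W`: the plots of `E` that take values in `W`. -/
@[reducible]
def subsetDiffeology {E : Type*} [AddCommGroup E] [Module ℝ E] (d : DiffeologicalSpace E)
    (W : Submodule ℝ E) : DiffeologicalSpace W :=
  pullback Subtype.val d

/-- A diffeology on a finite-dimensional real vector space is standard if its plots are exactly
the ordinary smooth maps. -/
def IsStandard {E : Type*} [NormedAddCommGroup E] [NormedSpace ℝ E] [FiniteDimensional ℝ E]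
    (d : DiffeologicalSpace E) : Prop :=
  d = NormedSpace.toDiffeology E

open Classical in
/-- The indicator function of the irrational numbers. -/
noncomputable def deltaQ (x : ℝ) : ℝ :=
  if x ∈ Set.range ((↑) : ℚ → ℝ) then 0 else 1

/-- The vector space diffeology on `ℝ²` generated by `x ↦ (|x|, |x|)` and `x ↦ (0, Δ_ℚ(x))`. -/
@[reducible]
noncomputable def diffeologyV : DiffeologicalSpace (ℝ × ℝ) :=
  vectorSpaceDiffeologyGeneratedBy {fun x : ℝ => (|x|, |x|), fun x : ℝ => (0, deltaQ x)}

end DiffVS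

/-!
The point is that `x ↦ (0, |x|)` is a plot of `V`; since `x ↦ (|x|, |x|)` is one by definition and
plots can be added and scaled, every `x ↦ (a * |x|, b * |x|)` is then a plot, and inside a subspace
containing `(a, b) ≠ 0` such a map is not smooth in the ordinary sense, because `|x|` is not
differentiable at `0`.

Multiplying plots by smooth functions, adding them and reparametrising them shows that
`x ↦ (0, ∑ᵢ hᵢ(x) Δ(kᵢ(x)))` is a plot for all smooth `hᵢ`, `kᵢ`. So it suffices to write `|x|` in
this form, and as `|x| = x * s(x)` with `s = 1` on `(0, ∞)` and `s = -1` on `(-∞, 0]`, it suffices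
to write `s` as a combination of functions `Δ ∘ kᵢ`.

The function `Δ` is invariant under rational translations. Let `u` be a smooth function such
that `θ = u(0)` is irrational and, for each `x > 0`, at least one of `u(x)`, `u(4x)` is rational.
Then
`Δ(u(x) - θ) + Δ(u(4x) - θ) - Δ(u(x) + u(4x) - θ)`
equals `1` for `x > 0`: the summand with rational value of `u` contributes `1`, and the other
two cancel. At `x = 0` it equals `0 + 0 - 1 = -1`. Precomposing with the smooth function that
vanishes on `(-∞, 0]` and equals `exp (-1/x)` on `(0, ∞)` gives `s`
(`mul_jump_expNegInvGlue`).

Such a function `u` (`staircase`) is a smooth staircase with rational steps accumulating at an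
irrational height:
`u(x) = ∑ₙ 2^(-n!) B(16ⁿ x)`, where `B` is a bump function equal to `1` on `[-1, 1]` and vanishing
outside `(-2, 2)`. Its value at `0` is a Liouville number, and the factors `2^(-n!)` decay fast
enough to make the series converge together with all its derivatives (`contDiff_staircase`). It
moves only on the intervals `16⁻ⁿ (1, 2)`, and these are disjoint from their quarters, whence the
condition on `u(x)` and `u(4x)` (`exists_ratCast_eq_staircase_or`).
-/

namespace DiffVS

/-! ### Curve plots of vector space diffeologies -/

section CurvePlots

variable {E : Type*} [AddCommGroup E] [Module ℝ E] {d : DiffeologicalSpace E}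

theorem IsCurvePlot.add (hd : IsVectorSpaceDiffeology d) {c₁ c₂ : ℝ → E}
    (h₁ : IsCurvePlot d c₁) (h₂ : IsCurvePlot d c₂) :
    IsCurvePlot d fun x => c₁ x + c₂ x :=
  hd.smooth_add 1 (fun t => (c₁ (t 0), c₂ (t 0)))
    (DiffeologicalSpace.isPlot_inf_iff.2 ⟨h₁, h₂⟩)

theorem IsCurvePlot.smul (hd : IsVectorSpaceDiffeology d) {f : ℝ → ℝ} (hf : ContDiff ℝ ∞ f)
    {c : ℝ → E} (hc : IsCurvePlot d c) : IsCurvePlot d fun x => f x • c x := by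
  have hf' : ContDiff ℝ ∞ fun t : EuclideanSpace ℝ (Fin 1) => f (t 0) :=
    hf.comp (by fun_prop)
  exact hd.smooth_smul 1 (fun t => (f (t 0), c (t 0)))
    (DiffeologicalSpace.isPlot_inf_iff.2 ⟨hf', hc⟩)

theorem IsCurvePlot.comp {X : Type*} {d : DiffeologicalSpace X} {c : ℝ → X}
    (hc : IsCurvePlot d c) {f : ℝ → ℝ} (hf : ContDiff ℝ ∞ f) :
    IsCurvePlot d fun x => c (f x) := by
  have hf' : ContDiff ℝ ∞ fun t : EuclideanSpace ℝ (Fin 1) =>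
      (WithLp.toLp 2 fun _ => f (t 0) : EuclideanSpace ℝ (Fin 1)) := by
    rw [contDiff_euclidean]
    intro i
    exact hf.comp (by fun_prop)
  exact d.plot_reparam hc hf'

theorem isCurvePlot_toDiffeology_iff {F : Type*} [NormedAddCommGroup F] [NormedSpace ℝ F]
    [FiniteDimensional ℝ F] {c : ℝ → F} :
    IsCurvePlot (NormedSpace.toDiffeology F) c ↔ ContDiff ℝ ∞ c := by
  constructor
  · intro h
    have h' : ContDiff ℝ ∞ fun t : EuclideanSpace ℝ (Fin 1) => c (t 0) := h
    have hf : ContDiff ℝ ∞ fun x : ℝ =>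
        (WithLp.toLp 2 fun _ => x : EuclideanSpace ℝ (Fin 1)) := by
      rw [contDiff_euclidean]
      intro i
      exact contDiff_id
    exact h'.comp hf
  · intro h
    have h' : ContDiff ℝ ∞ fun t : EuclideanSpace ℝ (Fin 1) => c (t 0) :=
      h.comp (by fun_prop)
    exact h'

end CurvePlots

/-! ### The indicator function of the irrational numbers -/

theorem deltaQ_ratCast (q : ℚ) : deltaQ q = 0 :=
  if_pos ⟨q, rfl⟩

theorem deltaQ_of_irrational {x : ℝ} (hx : Irrational x) : deltaQ x = 1 :=
  if_neg hx

theorem deltaQ_ratCast_add (q : ℚ) (x : ℝ) : deltaQ (q + x) = deltaQ x := by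
  by_cases hx : Irrational x
  · rw [deltaQ_of_irrational hx, deltaQ_of_irrational (hx.ratCast_add q)]
  · obtain ⟨r, rfl⟩ := not_not.1 hx
    rw [← Rat.cast_add, deltaQ_ratCast, deltaQ_ratCast]

/-! ### A smooth staircase with rational steps and irrational limit -/

/-- A smooth bump function on `ℝ`, equal to `1` on `[-1, 1]` and to `0` outside `(-2, 2)`. -/
noncomputable def bump : ContDiffBump (0 : ℝ) :=
  ⟨1, 2, one_pos, one_lt_two⟩

theorem bump_of_abs_le_one {x : ℝ} (hx : |x| ≤ 1) : bump x = 1 :=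
  bump.one_of_mem_closedBall (by simpa [bump] using hx)

theorem bump_of_two_le {x : ℝ} (hx : 2 ≤ x) : bump x = 0 :=
  bump.zero_of_le_dist (by simpa [bump] using hx.trans (le_abs_self x))

/-- The staircase `x ↦ ∑ₙ 2^(-n!) B(16ⁿ x)`, with `B` the bump function `bump`. For `x > 0` the
sum is finite, and it is locally constant with a rational value outside the intervals
`16⁻ⁿ (1, 2)`. -/
noncomputable def staircase (x : ℝ) : ℝ :=
  ∑' n : ℕ, 1 / (2 : ℝ) ^ n.factorial * bump (16 ^ n * x)

theorem summable_pow_div_two_pow_factorial (k : ℕ) :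
    Summable fun n : ℕ => 1 / (2 : ℝ) ^ n.factorial * (16 ^ n) ^ k := by
  refine Summable.of_norm_bounded_eventually_nat (g := fun n => (1 / 2 : ℝ) ^ n)
    (summable_geometric_of_lt_one (by norm_num) (by norm_num)) ?_
  filter_upwards [Filter.eventually_ge_atTop (4 * k + 2)] with n hn
  -- The factorial outgrows every linear function: `n! ≥ n * (n - 1) ≥ n * (4 * k + 1)`.
  have hexp : 4 * n * k + n ≤ n.factorial := by
    obtain ⟨m, rfl⟩ : ∃ m, n = m + 1 := ⟨n - 1, by omega⟩
    rw [Nat.factorial_succ]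
    calc 4 * (m + 1) * k + (m + 1) = (m + 1) * (4 * k + 1) := by ring
      _ ≤ (m + 1) * m.factorial :=
        Nat.mul_le_mul_left _ ((by omega : 4 * k + 1 ≤ m).trans (Nat.self_le_factorial m))
  have hpow : (2 : ℝ) ^ (4 * n * k) * 2 ^ n ≤ 2 ^ n.factorial := by
    rw [← pow_add]
    exact pow_le_pow_right₀ one_le_two hexp
  have h16 : ((16 : ℝ) ^ n) ^ k = 2 ^ (4 * n * k) := by
    rw [← pow_mul, mul_assoc, pow_mul 2 4]
    norm_num
  rw [Real.norm_of_nonneg (by positivity), h16, one_div_pow, one_div_mul_eq_div,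
    div_le_div_iff₀ (by positivity) (by positivity), one_mul]
  exact hpow

theorem contDiff_tsum_mul_comp_const_mul {f : ℝ → ℝ} (hf : ContDiff ℝ ∞ f)
    (hsupp : HasCompactSupport f) {a r : ℕ → ℝ} (ha : ∀ n, 0 ≤ a n) (hr : ∀ n, 0 ≤ r n)
    (hsum : ∀ k : ℕ, Summable fun n => a n * r n ^ k) :
    ContDiff ℝ ∞ fun x => ∑' n, a n * f (r n * x) := by
  have hfk : ∀ k : ℕ, ContDiff ℝ k f := fun k => hf.of_le (by exact_mod_cast le_top)
  have hbound : ∀ k : ℕ, ∃ C, ∀ x, ‖iteratedFDeriv ℝ k f x‖ ≤ C := fun k =>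
    (hsupp.iteratedFDeriv k).exists_bound_of_continuous
      ((hfk k).continuous_iteratedFDeriv le_rfl)
  choose C hC using hbound
  have hderiv : ∀ (k n : ℕ) (x : ℝ),
      ‖iteratedFDeriv ℝ k (fun y => a n * f (r n * y)) x‖ ≤ a n * r n ^ k * C k := by
    intro k n x
    have hnonneg : 0 ≤ a n * r n ^ k := mul_nonneg (ha n) (pow_nonneg (hr n) k)
    rw [norm_iteratedFDeriv_eq_norm_iteratedDeriv, iteratedDeriv_const_mul_field,
      iteratedDeriv_comp_const_mul (hfk k), ← mul_assoc, norm_mul,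
      Real.norm_of_nonneg hnonneg, ← norm_iteratedFDeriv_eq_norm_iteratedDeriv]
    exact mul_le_mul_of_nonneg_left (hC k _) hnonneg
  exact contDiff_tsum (v := fun k n => a n * r n ^ k * C k)
    (fun n => contDiff_const.mul (hf.comp (contDiff_const.mul contDiff_id)))
    (fun k _ => (hsum k).mul_right (C k)) fun k n x _ => hderiv k n x

theorem contDiff_staircase : ContDiff ℝ ∞ staircase :=
  contDiff_tsum_mul_comp_const_mul bump.contDiff bump.hasCompactSupport
    (fun _ => by positivity) (fun _ => by positivity) summable_pow_div_two_pow_factorial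

theorem irrational_staircase_zero : Irrational (staircase 0) := by
  have h : staircase 0 = liouvilleNumber (2 : ℕ) := by
    simp [staircase, liouvilleNumber, bump_of_abs_le_one]
  rw [h]
  exact (liouville_liouvilleNumber le_rfl).irrational

theorem exists_ratCast_eq_staircase {x : ℝ} (hx : 0 < x)
    (h : ∀ n : ℕ, 16 ^ n * x ≤ 1 ∨ 2 ≤ 16 ^ n * x) : ∃ q : ℚ, (q : ℝ) = staircase x := by
  obtain ⟨N, hN⟩ := pow_unbounded_of_one_lt (2 / x) (by norm_num : (1 : ℝ) < 16)
  have hvanish : ∀ n ∉ Finset.range N,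
      1 / (2 : ℝ) ^ n.factorial * bump (16 ^ n * x) = 0 := by
    intro n hn
    have hNn : (16 : ℝ) ^ N ≤ 16 ^ n :=
      pow_le_pow_right₀ (by norm_num) (not_lt.1 fun h => hn (Finset.mem_range.2 h))
    rw [bump_of_two_le ((div_le_iff₀ hx).1 (hN.le.trans hNn)), mul_zero]
  refine ⟨∑ n ∈ Finset.range N,
    1 / (2 : ℚ) ^ n.factorial * if 16 ^ n * x ≤ 1 then 1 else 0, ?_⟩
  rw [staircase, tsum_eq_sum hvanish]
  push_cast
  refine Finset.sum_congr rfl fun n _ => ?_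
  have h0 : 0 < 16 ^ n * x := by positivity
  split_ifs with hn
  · rw [bump_of_abs_le_one (by rwa [abs_of_pos h0]), Rat.cast_one]
  · rw [bump_of_two_le ((h n).resolve_left hn), Rat.cast_zero]

/-- The intervals `16⁻ⁿ (1, 2)`, on which `staircase` moves, are disjoint from the intervals
`16⁻ᵐ (1/4, 1/2)`, on which `x ↦ staircase (4 * x)` moves. -/
theorem exists_ratCast_eq_staircase_or {x : ℝ} (hx : 0 < x) :
    (∃ q : ℚ, (q : ℝ) = staircase x) ∨ ∃ q : ℚ, (q : ℝ) = staircase (4 * x) := by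
  by_contra! hcon
  obtain ⟨n, hn⟩ : ∃ n : ℕ, 1 < 16 ^ n * x ∧ 16 ^ n * x < 2 := by
    by_contra! h
    obtain ⟨q, hq⟩ := exists_ratCast_eq_staircase hx fun n =>
      (le_or_gt (16 ^ n * x) 1).imp_right (h n)
    exact hcon.1 q hq
  obtain ⟨m, hm⟩ : ∃ m : ℕ, 1 < 16 ^ m * (4 * x) ∧ 16 ^ m * (4 * x) < 2 := by
    by_contra! h
    obtain ⟨q, hq⟩ := exists_ratCast_eq_staircase (by positivity : 0 < 4 * x) fun n =>
      (le_or_gt (16 ^ n * (4 * x)) 1).imp_right (h n)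
    exact hcon.2 q hq
  rcases le_or_gt n m with hnm | hnm
  · have : (16 : ℝ) ^ n ≤ 16 ^ m := pow_le_pow_right₀ (by norm_num) hnm
    have := mul_le_mul_of_nonneg_right this hx.le
    linarith
  · have : (16 : ℝ) ^ (m + 1) ≤ 16 ^ n := pow_le_pow_right₀ (by norm_num) hnm
    rw [pow_succ] at this
    have := mul_le_mul_of_nonneg_right this hx.le
    linarith

/-! ### The sign function as a combination of reparametrised indicator functions -/

/-- A combination of reparametrised copies of `deltaQ` that equals `1` on `(0, ∞)` and `-1` at
`0`. -/
noncomputable def jump (x : ℝ) : ℝ :=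
  deltaQ (staircase x - staircase 0) + deltaQ (staircase (4 * x) - staircase 0)
    - deltaQ (staircase x + staircase (4 * x) - staircase 0)

theorem jump_of_pos {x : ℝ} (hx : 0 < x) : jump x = 1 := by
  have hirr : deltaQ (-staircase 0) = 1 := deltaQ_of_irrational irrational_staircase_zero.neg
  rcases exists_ratCast_eq_staircase_or hx with ⟨q, hq⟩ | ⟨q, hq⟩
  · rw [jump, ← hq, sub_eq_add_neg (q : ℝ), deltaQ_ratCast_add, hirr, add_sub_assoc (q : ℝ),
      deltaQ_ratCast_add, add_sub_cancel_right]
  · rw [jump, ← hq, sub_eq_add_neg (q : ℝ), deltaQ_ratCast_add, hirr, add_comm (staircase x),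
      add_sub_assoc (q : ℝ), deltaQ_ratCast_add, add_sub_cancel_left]

theorem jump_zero : jump 0 = -1 := by
  have h0 : deltaQ 0 = 0 := by simpa using deltaQ_ratCast 0
  simp [jump, h0, deltaQ_of_irrational irrational_staircase_zero]

theorem mul_jump_expNegInvGlue (x : ℝ) : x * jump (expNegInvGlue x) = |x| := by
  rcases le_or_gt x 0 with hx | hx
  · rw [expNegInvGlue.zero_of_nonpos hx, jump_zero, abs_of_nonpos hx, mul_neg_one]
  · rw [jump_of_pos (expNegInvGlue.pos_of_pos hx), abs_of_pos hx, mul_one]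

/-! ### Plots of `V` -/

theorem isVectorSpaceDiffeology_diffeologyV : IsVectorSpaceDiffeology diffeologyV :=
  (isLeast_vectorSpaceDiffeologyGeneratedBy _).1.1

theorem isCurvePlot_diffeologyV_abs : IsCurvePlot diffeologyV fun x => (|x|, |x|) :=
  (isLeast_vectorSpaceDiffeologyGeneratedBy _).1.2 _ (Or.inl rfl)

theorem isCurvePlot_diffeologyV_deltaQ_comp {f : ℝ → ℝ} (hf : ContDiff ℝ ∞ f) :
    IsCurvePlot diffeologyV fun x => (0, deltaQ (f x)) :=
  IsCurvePlot.comp (c := fun x => ((0 : ℝ), deltaQ x))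
    ((isLeast_vectorSpaceDiffeologyGeneratedBy _).1.2 _ (Or.inr rfl)) hf

theorem isCurvePlot_diffeologyV_zero_abs : IsCurvePlot diffeologyV fun x => (0, |x|) := by
  have hV := isVectorSpaceDiffeology_diffeologyV
  have hu := contDiff_staircase
  have hu4 : ContDiff ℝ ∞ fun x => staircase (4 * x) :=
    hu.comp (contDiff_const.mul contDiff_id)
  have h1 := isCurvePlot_diffeologyV_deltaQ_comp (hu.sub (contDiff_const (c := staircase 0)))
  have h2 := isCurvePlot_diffeologyV_deltaQ_comp (hu4.sub (contDiff_const (c := staircase 0)))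
  have h3 := isCurvePlot_diffeologyV_deltaQ_comp
    ((hu.add hu4).sub (contDiff_const (c := staircase 0)))
  have h := ((h1.add hV h2).add hV (h3.smul hV (contDiff_const (c := (-1 : ℝ))))).comp
    (expNegInvGlue.contDiff (n := ⊤))
  convert! h.smul hV contDiff_id using 2 with x
  refine Prod.ext (by simp) ?_
  rw [← mul_jump_expNegInvGlue x]
  simp [jump, sub_eq_add_neg]

theorem isCurvePlot_diffeologyV_abs_smul (a b : ℝ) :
    IsCurvePlot diffeologyV fun x => (a * |x|, b * |x|) := by
  have hV := isVectorSpaceDiffeology_diffeologyV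
  convert! (isCurvePlot_diffeologyV_abs.smul hV (contDiff_const (c := a))).add hV
    (isCurvePlot_diffeologyV_zero_abs.smul hV (contDiff_const (c := b - a))) using 2 with x
  refine Prod.ext ?_ ?_
  · simp
  · simp only [Prod.smul_mk, Prod.mk_add_mk, smul_eq_mul]
    ring

/-! ### Non-standard subspaces -/

theorem isCurvePlot_subsetDiffeology_abs_smul {W : Submodule ℝ (ℝ × ℝ)} (w : W) :
    IsCurvePlot (subsetDiffeology diffeologyV W) fun x => |x| • w := by
  change IsCurvePlot diffeologyV fun x => ((|x| • w : W) : ℝ × ℝ)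
  convert! isCurvePlot_diffeologyV_abs_smul (w : ℝ × ℝ).1 (w : ℝ × ℝ).2 using 2 with x
  exact Prod.ext (mul_comm _ _) (mul_comm _ _)

theorem not_isCurvePlot_toDiffeology_abs_smul {F : Type*} [NormedAddCommGroup F]
    [NormedSpace ℝ F] [FiniteDimensional ℝ F] {w : F} (hw : w ≠ 0) :
    ¬ IsCurvePlot (NormedSpace.toDiffeology F) fun x => |x| • w := by
  rw [isCurvePlot_toDiffeology_iff]
  intro h
  -- Composing with a functional that norms `w` turns the curve into `x ↦ ‖w‖ * |x|`.
  obtain ⟨φ, -, hφ⟩ := exists_dual_vector ℝ w (norm_ne_zero_iff.2 hw)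
  have hd : DifferentiableAt ℝ (fun x : ℝ => ‖w‖⁻¹ * φ (|x| • w)) 0 :=
    ((φ.contDiff.comp h).differentiable (by simp) 0).const_mul _
  refine not_differentiableAt_abs_zero (hd.congr_of_eventuallyEq (.of_forall fun x => ?_))
  have : ‖w‖ ≠ 0 := norm_ne_zero_iff.2 hw
  simp only [map_smul, hφ, smul_eq_mul, RCLike.ofReal_real_eq_id, id]
  field_simp

end DiffVS

theorem mainTheorem2 :
    (∀ W : Submodule ℝ (ℝ × ℝ), W ≠ ⊥ →
      ¬ DiffVS.IsStandard (DiffVS.subsetDiffeology DiffVS.diffeologyV W)) ∧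
    (∀ a b : ℝ, DiffVS.IsCurvePlot DiffVS.diffeologyV fun x : ℝ => (a * |x|, b * |x|)) ∧
    (∀ a b : ℝ, (a, b) ≠ (0, 0) →
      ∃ c : ℝ → Submodule.span ℝ {((a, b) : ℝ × ℝ)},
        (∀ x : ℝ, (c x : ℝ × ℝ) = (a * |x|, b * |x|)) ∧
        DiffVS.IsCurvePlot
          (DiffVS.subsetDiffeology DiffVS.diffeologyV (Submodule.span ℝ {((a, b) : ℝ × ℝ)})) c ∧
        ¬ DiffVS.IsCurvePlot
          (NormedSpace.toDiffeology (Submodule.span ℝ {((a, b) : ℝ × ℝ)})) c) := by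
  refine ⟨fun W hW hstd => ?_, DiffVS.isCurvePlot_diffeologyV_abs_smul, fun a b hab => ?_⟩
  · obtain ⟨w, hwW, hw⟩ := W.exists_mem_ne_zero_of_ne_bot hW
    have hplot := DiffVS.isCurvePlot_subsetDiffeology_abs_smul (⟨w, hwW⟩ : W)
    rw [hstd] at hplot
    exact DiffVS.not_isCurvePlot_toDiffeology_abs_smul (by simpa using hw) hplot
  · set w : Submodule.span ℝ {((a, b) : ℝ × ℝ)} := ⟨(a, b), Submodule.mem_span_singleton_self _⟩
      with hw
    have hw0 : w ≠ 0 := fun h => hab (congrArg Subtype.val h)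
    exact ⟨fun x => |x| • w, fun x => Prod.ext (mul_comm _ _) (mul_comm _ _),
      DiffVS.isCurvePlot_subsetDiffeology_abs_smul w,
      DiffVS.not_isCurvePlot_toDiffeology_abs_smul hw0⟩
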